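/- For a positive integer $n$ let $d(n)$ denote the number of positive divisors of $n$, and call $n$ highly composite if $d(m) < d(n)$ for every positive integer $m < n$. Then the positive integers $n$ such that both $n$ and $d(n)$ are highly composite are exactly the following $18$ values: $1$, $2$, $6$, $12$, $60$, $360$, $1260$, $2520$, $5040$, $55440$, $277200$, $720720$, $3603600$, $61261200$, $2205403200$, $293318625600$, $6746328388800$ and $195643523275200$. The corresponding values of $d(n)$ are, in the same order, $1$, $2$, $4$, $6$, $12$, $24$, $36$, $48$, $60$, $120$, $180$, $240$, $360$, $720$, $1680$, $5040$, $10080$ and $20160$. -/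

import Mathlib

/-- A positive integer `n` is highly composite if every smaller positive integer has strictly fewer
positive divisors than `n` has. -/
def IsHighlyComposite (n : ℕ) : Prop :=
  0 < n ∧ ∀ m : ℕ, 0 < m → m < n → m.divisors.card < n.divisors.card

/-! Exchanging prime factors shows that a highly composite n has nonincreasing exponents, that the
exponent of r is about 2 log q / log r at most when the prime q does not divide n, and that few of
its largest primes have exponent above 1. So many primes divide n exactly once, and d(n) is
divisible by a high power of 2. But the primes dividing d(n) are at most the exponent of 2 in n plus
1, so some small prime misses d(n). If d(n) is highly composite too, its exponent of 2 is then tiny.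
This contradiction (`card_lt_of_factorization_eq_one`) bounds the primes of n by 40
(`prime_lt_of_dvd`).

The primes of d(n) are then at most 11, which leaves finitely many candidates M for d(n). Each is
the divisor count of a listed n, is not highly composite, or is not attained, and
`searchDivisorCount` certifies the claims that need a search. A highly composite number is
determined by its divisor count, so the list is complete. -/

/-! ### Divisor counts after splitting off a prime power. -/

theorem exists_eq_pow_mul_coprime {n p : ℕ} (hn : n ≠ 0) (hp : p.Prime) :
    ∃ w, 0 < w ∧ ¬ p ∣ w ∧ n = p ^ n.factorization p * w ∧
      ∀ q, q ≠ p → w.factorization q = n.factorization q := by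
  refine ⟨n / p ^ n.factorization p, Nat.ordCompl_pos p hn, Nat.not_dvd_ordCompl hp hn,
    (Nat.ordProj_mul_ordCompl_eq_self n p).symm, fun q hq => ?_⟩
  rw [Nat.factorization_ordCompl, Finsupp.erase_ne hq]

theorem card_divisors_prime_pow_mul {p w : ℕ} (a : ℕ) (hp : p.Prime) (h : ¬ p ∣ w) :
    (p ^ a * w).divisors.card = (a + 1) * w.divisors.card := by
  rw [Nat.Coprime.card_divisors_mul (((Nat.Prime.coprime_iff_not_dvd hp).2 h).pow_left a),
    Nat.divisors_prime_pow hp]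
  simp

theorem card_divisors_prime_mul {p w : ℕ} (hp : p.Prime) (h : ¬ p ∣ w) :
    (p * w).divisors.card = 2 * w.divisors.card := by
  simpa using card_divisors_prime_pow_mul 1 hp h

theorem Nat.Prime.not_dvd_pow_mul {p q w a : ℕ} (hp : p.Prime) (hq : q.Prime) (hpq : p ≠ q)
    (h : ¬ p ∣ w) : ¬ p ∣ q ^ a * w := by
  intro hd
  rcases (Nat.Prime.dvd_mul hp).1 hd with h1 | h1
  · exact hpq ((Nat.prime_dvd_prime_iff_eq hp hq).1 (hp.dvd_of_dvd_pow h1))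
  · exact h h1

theorem card_divisors_pos {w : ℕ} (h : 0 < w) : 0 < w.divisors.card :=
  Finset.card_pos.2 ⟨1, by simp [h.ne']⟩

/-! ### Exchange arguments. -/

namespace IsHighlyComposite

variable {n : ℕ}

theorem le_of_card_le (h : IsHighlyComposite n) {m : ℕ} (hm : 0 < m)
    (hd : n.divisors.card ≤ m.divisors.card) : n ≤ m := by
  by_contra hlt
  exact absurd (h.2 m hm (not_le.1 hlt)) (not_lt.2 hd)

/-- Otherwise swapping the two exponents keeps the divisor count and gives a smaller number. -/
theorem factorization_anti (h : IsHighlyComposite n) {p q : ℕ} (hp : p.Prime) (hq : q.Prime)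
    (hpq : p ≤ q) : n.factorization q ≤ n.factorization p := by
  rcases hpq.eq_or_lt with rfl | hpq
  · exact le_rfl
  by_contra hlt
  rw [not_le] at hlt
  obtain ⟨w, hw0, hpw, hn, hw⟩ := exists_eq_pow_mul_coprime h.1.ne' hp
  obtain ⟨v, hv0, hqv, hwv, -⟩ := exists_eq_pow_mul_coprime hw0.ne' hq
  rw [hw q hpq.ne'] at hwv
  set a := n.factorization p
  set b := n.factorization q
  have hpv : ¬ p ∣ v := fun hd => hpw (hwv ▸ hd.mul_left _)
  have hcard : ∀ s t, (p ^ s * (q ^ t * v)).divisors.card =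
      (s + 1) * ((t + 1) * v.divisors.card) := fun s t => by
    rw [card_divisors_prime_pow_mul s hp (hp.not_dvd_pow_mul hq hpq.ne hpv),
      card_divisors_prime_pow_mul t hq hqv]
  have hle := h.le_of_card_le (m := p ^ b * (q ^ a * v))
    (by have := hp.pos; have := hq.pos; positivity)
    (by rw [hn, hwv, hcard, hcard]; exact le_of_eq (by ring))
  rw [hn, hwv] at hle
  obtain ⟨c, hc⟩ := Nat.exists_eq_add_of_lt hlt
  rw [hc, pow_add, pow_add, pow_add, pow_add, pow_one, pow_one] at hle
  have h1 : p ^ c * p < q ^ c * q := by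
    have := Nat.pow_lt_pow_left hpq (n := c + 1) (by omega)
    simpa [pow_succ] using this
  have h2 : 0 < p ^ a * q ^ a * v := by
    have := hp.pos; have := hq.pos; positivity
  nlinarith [Nat.mul_lt_mul_of_pos_left h1 h2]

/-- Trade `r ^ s` for `q`: the factor a + 1 of the count becomes 2(a - s + 1), which is no smaller
once a + 1 ≥ 2s. -/
theorem factorization_succ_lt_two_mul (h : IsHighlyComposite n) {r q s : ℕ} (hr : r.Prime)
    (hq : q.Prime) (hqn : ¬ q ∣ n) (hs : q < r ^ s) : n.factorization r + 1 < 2 * s := by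
  have hs0 : 0 < s := by
    rcases Nat.eq_zero_or_pos s with rfl | h0
    · have := hq.one_lt; simp at hs; omega
    · exact h0
  by_contra hlt
  rw [not_lt] at hlt
  obtain ⟨w, hw0, hrw, hn, -⟩ := exists_eq_pow_mul_coprime h.1.ne' hr
  set a := n.factorization r
  obtain ⟨b, hb⟩ : ∃ b, a = b + s := ⟨a - s, by omega⟩
  have hqw : ¬ q ∣ w := fun hd => hqn (hn ▸ hd.mul_left _)
  have hqr : r ≠ q := by
    rintro rfl
    exact hqn (hn ▸ (dvd_pow_self r (by omega : a ≠ 0)).mul_right w)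
  have hle := h.le_of_card_le (m := r ^ b * (q * w))
    (by have := hr.pos; have := hq.pos; positivity) (by
      rw [hn, card_divisors_prime_pow_mul a hr hrw, card_divisors_prime_pow_mul b hr
        (by simpa using hr.not_dvd_pow_mul (a := 1) hq hqr hrw),
        card_divisors_prime_mul hq hqw, ← mul_assoc]
      exact Nat.mul_le_mul_right _ (by omega))
  rw [hn, hb, pow_add] at hle
  have h2 : 0 < r ^ b * w := by
    have := hr.pos; positivity
  nlinarith [Nat.mul_lt_mul_of_pos_left hs h2]

/-- Trade `p * q * r` for `s * t`: the new primes multiply the count by 4, and the three lowered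
exponents cost at most (3/2)³ = 27/8. -/
theorem prod_le_of_two_le_factorization (h : IsHighlyComposite n) {p q r s t : ℕ}
    (hp : p.Prime) (hq : q.Prime) (hr : r.Prime) (hs : s.Prime) (ht : t.Prime)
    (hpq : p ≠ q) (hpr : p ≠ r) (hqr : q ≠ r) (hst : s ≠ t)
    (hp2 : 2 ≤ n.factorization p) (hq2 : 2 ≤ n.factorization q) (hr2 : 2 ≤ n.factorization r)
    (hsn : ¬ s ∣ n) (htn : ¬ t ∣ n) : p * q * r ≤ s * t := by
  by_contra hlt
  rw [not_le] at hlt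
  obtain ⟨u, hu0, hpu, hn, hu⟩ := exists_eq_pow_mul_coprime h.1.ne' hp
  obtain ⟨v, hv0, hqv, huv, hv⟩ := exists_eq_pow_mul_coprime hu0.ne' hq
  obtain ⟨w, hw0, hrw, hvw, -⟩ := exists_eq_pow_mul_coprime hv0.ne' hr
  rw [hv r hqr.symm, hu r hpr.symm] at hvw
  rw [hu q hpq.symm] at huv
  obtain ⟨a, ha⟩ := Nat.exists_eq_add_of_le' hp2
  obtain ⟨b, hb⟩ := Nat.exists_eq_add_of_le' hq2
  obtain ⟨c, hc⟩ := Nat.exists_eq_add_of_le' hr2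
  rw [hc] at hvw
  rw [hb, hvw] at huv
  rw [ha, huv] at hn
  have hpw : ¬ p ∣ w := fun hd => hpu (huv ▸ (hd.mul_left _).mul_left _)
  have hqw : ¬ q ∣ w := fun hd => hqv (hvw ▸ hd.mul_left _)
  have hcard : ∀ i j k x, ¬ p ∣ x → ¬ q ∣ x → ¬ r ∣ x →
      (p ^ i * (q ^ j * (r ^ k * x))).divisors.card =
      (i + 1) * ((j + 1) * ((k + 1) * x.divisors.card)) := fun i j k x h1 h2 h3 => by
    rw [card_divisors_prime_pow_mul i hp (hp.not_dvd_pow_mul hq hpq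
      (hp.not_dvd_pow_mul hr hpr h1)),
      card_divisors_prime_pow_mul j hq (hq.not_dvd_pow_mul hr hqr h2),
      card_divisors_prime_pow_mul k hr h3]
  have hdvd : ∀ x, 2 ≤ n.factorization x → x ∣ n := fun x hx =>
    Nat.dvd_of_factorization_pos (by omega)
  have key : ∀ x, x.Prime → x ∣ n → ¬ x ∣ w → ¬ x ∣ s * (t * w) := by
    intro x hx hxn hxw
    have e1 : x ≠ s := fun e => hsn (e ▸ hxn)
    have e2 : x ≠ t := fun e => htn (e ▸ hxn)
    simpa using hx.not_dvd_pow_mul (a := 1) hs e1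
      (hx.not_dvd_pow_mul (a := 1) ht e2 hxw)
  have hwn : w ∣ n := hn ▸ (((dvd_mul_left _ _).mul_left _).mul_left _)
  have htw : ¬ t ∣ w := fun hd => htn (hd.trans hwn)
  have hsw : ¬ s ∣ t * w := by
    simpa using hs.not_dvd_pow_mul (a := 1) ht hst fun hd => hsn (hd.trans hwn)
  have hd0 := card_divisors_pos hw0
  have hle := h.le_of_card_le (m := p ^ (a + 1) * (q ^ (b + 1) * (r ^ (c + 1) * (s * (t * w)))))
    (by have := hp.pos; have := hq.pos; have := hr.pos; have := hs.pos; have := ht.pos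
        positivity) (by
      rw [hcard _ _ _ _ (key p hp (hdvd p hp2) hpw) (key q hq (hdvd q hq2) hqw)
        (key r hr (hdvd r hr2) hrw), card_divisors_prime_mul hs hsw,
        card_divisors_prime_mul ht htw]
      rw [hn, hcard _ _ _ _ hpw hqw hrw]
      have : (a + 3) * (b + 3) * (c + 3) ≤ 4 * ((a + 2) * (b + 2) * (c + 2)) := by
        nlinarith [Nat.zero_le (a * b), Nat.zero_le (a * c), Nat.zero_le (b * c),
          Nat.zero_le (a * b * c)]
      nlinarith [Nat.mul_le_mul_right w.divisors.card this])
  have h2 : 0 < p ^ (a + 1) * q ^ (b + 1) * r ^ (c + 1) * w := by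
    have := hp.pos; have := hq.pos; have := hr.pos; positivity
  have h3 := Nat.mul_lt_mul_of_pos_left hlt h2
  refine absurd hle (not_le.2 ?_)
  calc _ = p ^ (a + 1) * q ^ (b + 1) * r ^ (c + 1) * w * (s * t) := by ring
    _ < _ := h3
    _ = _ := by rw [hn]; ring

theorem prime_le_of_dvd_card_divisors (h : IsHighlyComposite n) {r : ℕ} (hr : r.Prime)
    (hd : r ∣ n.divisors.card) : r ≤ n.factorization 2 + 1 := by
  rw [Nat.card_divisors h.1.ne', hr.prime.dvd_finsetProd_iff] at hd
  obtain ⟨p, hp, hrp⟩ := hd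
  have hpp := Nat.prime_of_mem_primeFactors hp
  have := h.factorization_anti Nat.prime_two hpp hpp.two_le
  have := Nat.le_of_dvd (Nat.succ_pos _) hrp
  omega

theorem two_pow_card_dvd_card_divisors (hn : n ≠ 0) (T : Finset ℕ)
    (hT : ∀ t ∈ T, n.factorization t = 1) : 2 ^ T.card ∣ n.divisors.card := by
  rw [Nat.card_divisors hn]
  have hsub : T ⊆ n.primeFactors := fun t ht => by
    rw [← Nat.support_factorization, Finsupp.mem_support_iff, hT t ht]
    exact one_ne_zero
  refine dvd_trans (dvd_of_eq ?_) (Finset.prod_dvd_prod_of_subset _ _ _ hsub)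
  rw [Finset.prod_congr rfl (fun t ht => by rw [hT t ht]), Finset.prod_const]

/-- The number of primes dividing a highly composite `n` exactly once is at most the exponent of `2`
in the divisor count of `n`, which is small if that divisor count is highly composite. -/
theorem card_lt_of_factorization_eq_one (h : IsHighlyComposite n)
    (hM : IsHighlyComposite n.divisors.card) {q r s s' : ℕ} (hq : q.Prime) (hqn : ¬ q ∣ n)
    (hqs : q < 2 ^ s') (hr : r.Prime) (hsr : 2 * s' ≤ r) (hrs : r < 2 ^ s) (T : Finset ℕ)
    (hT : ∀ t ∈ T, n.factorization t = 1) : T.card + 1 < 2 * s := by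
  have h1 := h.factorization_succ_lt_two_mul Nat.prime_two hq hqn hqs
  -- Such an `r` would be at most the exponent of 2 in `n` plus 1, which is below `2 * s'`.
  have h2 : ¬ r ∣ n.divisors.card := fun hd => by
    have := h.prime_le_of_dvd_card_divisors hr hd
    omega
  have h3 := hM.factorization_succ_lt_two_mul Nat.prime_two hr h2 hrs
  have h4 := (Nat.prime_two.pow_dvd_iff_le_factorization hM.1.ne').1
    (two_pow_card_dvd_card_divisors h.1.ne' T hT)
  omega

/-- By the three-for-two exchange `p₃` has exponent at most 1, so all primes from `p₃` to `x` have
exponent exactly 1, and `T` exhibits too many of them. -/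
theorem not_dvd_of_window (h : IsHighlyComposite n) (hM : IsHighlyComposite n.divisors.card)
    {x p₁ p₂ p₃ q q' r s s' : ℕ} (T : List ℕ) (hx : x.Prime) (hxn : x ∣ n)
    (hq : q.Prime) (hq' : q'.Prime) (hqq : q < q') (hqn : ¬ q ∣ n) (hqn' : ¬ q' ∣ n)
    (hqs : q < 2 ^ s') (hr : r.Prime) (hsr : 2 * s' ≤ r) (hrs : r < 2 ^ s)
    (hp₁ : p₁.Prime) (hp₂ : p₂.Prime) (hp₃ : p₃.Prime) (h12 : p₁ < p₂) (h23 : p₂ < p₃)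
    (hlt : q * q' < p₁ * p₂ * p₃) (hT : ∀ t ∈ T, t.Prime ∧ p₃ ≤ t ∧ t ≤ x) (hnd : T.Nodup)
    (hcard : 2 * s ≤ T.length + 1) : False := by
  have h3 : n.factorization p₃ ≤ 1 := by
    by_contra hc
    have a2 := h.factorization_anti hp₂ hp₃ h23.le
    have a1 := h.factorization_anti hp₁ hp₂ h12.le
    exact absurd hlt (not_lt.2 (h.prod_le_of_two_le_factorization hp₁ hp₂ hp₃ hq hq' h12.ne
      (h12.trans h23).ne h23.ne hqq.ne (by omega) (by omega) (by omega) hqn hqn'))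
  have hx1 : 1 ≤ n.factorization x := hx.factorization_pos_of_dvd h.1.ne' hxn
  have := h.card_lt_of_factorization_eq_one hM hq hqn hqs hr hsr hrs T.toFinset fun t ht => by
    obtain ⟨ht1, ht2, ht3⟩ := hT t (by simpa using ht)
    have := h.factorization_anti hp₃ ht1 ht2
    have := h.factorization_anti ht1 hx ht3
    omega
  rw [List.toFinset_card_of_nodup hnd] at this
  omega

end IsHighlyComposite

/-! ### Bounding the prime factors of n: Chebyshev's estimate and explicit windows. -/

theorem two_pow_le_mul_primeCounting {j : ℕ} (hj : 0 < j) :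
    2 ^ j ≤ j * (Nat.primeCounting (2 ^ j) + 2) := by
  have h := Chebyshev.pi_ge (2 ^ j)
  have hl2 : 0 < Real.log 2 := Real.log_pos one_lt_two
  have hj' : (1 : ℝ) ≤ j := by exact_mod_cast hj
  have h1 : Real.log ((2 : ℝ) ^ j + 1) ≤ (j + 1) * Real.log 2 := by
    have : Real.log ((2 : ℝ) ^ (j + 1)) = (j + 1) * Real.log 2 := by
      rw [Real.log_pow]; push_cast; ring
    rw [← this]
    apply Real.log_le_log (by positivity)
    have : (1 : ℝ) ≤ 2 ^ j := one_le_pow₀ one_le_two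
    rw [pow_succ]; linarith
  push_cast at h
  rw [Real.log_pow, div_le_iff₀ (by positivity)] at h
  have h2 : ((2 : ℝ) ^ j) * Real.log 2 ≤
      (j * (Nat.primeCounting (2 ^ j) + 2)) * Real.log 2 := by nlinarith
  have h3 := le_of_mul_le_mul_right h2 hl2
  exact_mod_cast h3

theorem le_two_pow_of_five_le {i : ℕ} (hi : 5 ≤ i) : 3 * i + 12 ≤ 2 ^ i := by
  induction i, hi using Nat.le_induction with
  | base => norm_num
  | succ i _ ih => rw [pow_succ]; omega

theorem mul_add_lt_two_pow {j : ℕ} (hj : 25 ≤ j) :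
    j * (2 ^ ((2 * j + 7) / 3) + 2 * j + 3) < 2 ^ j := by
  have h1 : j ≤ 2 ^ ((j - 10) / 3) := (by omega : j ≤ 3 * ((j - 10) / 3) + 12).trans
    (le_two_pow_of_five_le (by omega))
  have h2 : j * 2 ^ ((2 * j + 7) / 3) ≤ 2 ^ (j - 1) :=
    (Nat.mul_le_mul_right _ h1).trans
      (by rw [← pow_add]; exact Nat.pow_le_pow_right two_pos (by omega))
  have h3 : j * (2 * j + 3) < 2 ^ (j - 1) := by
    clear h1 h2
    induction j, hj using Nat.le_induction with
    | base => norm_num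
    | succ i hi ih =>
      obtain ⟨k, rfl⟩ : ∃ k, i = k + 1 := ⟨i - 1, by omega⟩
      simp only [Nat.add_sub_cancel] at ih ⊢
      rw [pow_succ]
      nlinarith
  have h4 : 2 ^ j = 2 ^ (j - 1) + 2 ^ (j - 1) := by
    rw [← two_mul, ← pow_succ', Nat.sub_add_cancel (by omega)]
  nlinarith

namespace IsHighlyComposite

variable {n : ℕ}

theorem not_dvd_of_two_pow_le (h : IsHighlyComposite n) (hM : IsHighlyComposite n.divisors.card)
    {x : ℕ} (hx : x.Prime) (hxn : x ∣ n) (hmax : ∀ q, q.Prime → x < q → ¬ q ∣ n)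
    (hlarge : 2 ^ 25 ≤ x) : False := by
  obtain ⟨j, hj1, hj2⟩ : ∃ j, 2 ^ j ≤ x ∧ x < 2 ^ (j + 1) :=
    ⟨Nat.log 2 x, Nat.pow_log_le_self 2 hx.ne_zero, Nat.lt_pow_succ_log_self one_lt_two x⟩
  have hj : 25 ≤ j := by
    by_contra hc
    have := Nat.pow_le_pow_right two_pos (by omega : j + 1 ≤ 25)
    omega
  obtain ⟨q, hq, hxq, hq2⟩ := Nat.exists_prime_lt_and_le_two_mul x hx.ne_zero
  obtain ⟨q', hq', hqq, hqq2⟩ := Nat.exists_prime_lt_and_le_two_mul q hq.ne_zero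
  obtain ⟨r, hr, hjr, hr2⟩ := Nat.exists_prime_lt_and_le_two_mul (2 * (j + 2)) (by omega)
  have hmain := mul_add_lt_two_pow hj
  have hrs : r < 2 ^ j := by nlinarith [Nat.zero_le (2 ^ ((2 * j + 7) / 3))]
  -- Least `u` with 3u ≥ 2j + 5: three primes from `2 ^ u` on then have product above `q * q'`, as
  -- `q < 2 ^ (j + 2)` and `q' < 2 ^ (j + 3)`.
  set u := (2 * j + 7) / 3 with hu
  set T := (Nat.primesLE (2 ^ j)) \ Finset.range (2 ^ u) with hT
  have hTmem : ∀ t ∈ T, t.Prime ∧ 2 ^ u ≤ t ∧ t ≤ 2 ^ j := fun t ht => by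
    simp only [hT, Finset.mem_sdiff, Nat.mem_primesLE, Finset.mem_range, not_lt] at ht
    exact ⟨ht.1.2, ht.2, ht.1.1⟩
  have hTcard : Nat.primeCounting (2 ^ j) ≤ T.card + 2 ^ u := by
    have := Finset.le_card_sdiff (Finset.range (2 ^ u)) (Nat.primesLE (2 ^ j))
    rw [Finset.card_range, Nat.primesLE_card_eq_primeCounting, ← hT] at this
    omega
  have hB : (T.filter fun t => 2 ≤ n.factorization t).card ≤ 2 := by
    by_contra hc
    obtain ⟨a, b, c, ha, hb, hc, hab, hac, hbc⟩ := Finset.two_lt_card_iff.1 (not_le.1 hc)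
    rw [Finset.mem_filter] at ha hb hc
    obtain ⟨ha1, ha2, -⟩ := hTmem a ha.1
    obtain ⟨hb1, hb2, -⟩ := hTmem b hb.1
    obtain ⟨hc1, hc2, -⟩ := hTmem c hc.1
    have h1 := h.prod_le_of_two_le_factorization ha1 hb1 hc1 hq hq' hab hac hbc hqq.ne
      ha.2 hb.2 hc.2 (hmax q hq hxq) (hmax q' hq' (hxq.trans hqq))
    have h2 : 2 ^ u * 2 ^ u * 2 ^ u ≤ a * b * c :=
      Nat.mul_le_mul (Nat.mul_le_mul ha2 hb2) hc2
    have h3 : q * q' < 2 ^ (j + 2) * 2 ^ (j + 3) := by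
      apply Nat.mul_lt_mul'' <;> simp only [pow_succ] at hj2 ⊢ <;> omega
    rw [← pow_add] at h3
    rw [← pow_add, ← pow_add] at h2
    have h4 := Nat.pow_le_pow_right two_pos (by omega : j + 2 + (j + 3) ≤ u + u + u)
    omega
  have hC := h.card_lt_of_factorization_eq_one hM hq (hmax q hq hxq) (s' := j + 2)
    (by rw [pow_succ]; omega) hr hjr.le hrs (T.filter fun t => ¬ 2 ≤ n.factorization t)
    fun t ht => by
      rw [Finset.mem_filter] at ht
      obtain ⟨ht1, -, ht3⟩ := hTmem t ht.1
      have h1 := h.factorization_anti ht1 hx (ht3.trans hj1)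
      have h2 := hx.factorization_pos_of_dvd h.1.ne' hxn
      omega
  have hsplit := Finset.card_filter_add_card_filter_not (s := T)
    (fun t => 2 ≤ n.factorization t)
  have hpi := two_pow_le_mul_primeCounting (by omega : 0 < j)
  have := Nat.mul_le_mul_left j
    (by omega : Nat.primeCounting (2 ^ j) + 2 ≤ 2 ^ u + 2 * j + 3)
  omega

theorem prime_lt_of_dvd (h : IsHighlyComposite n) (hM : IsHighlyComposite n.divisors.card)
    {p : ℕ} (hp : p.Prime) (hpn : p ∣ n) : p < 41 := by
  by_contra hp41
  obtain ⟨x, hx, hmax⟩ := n.primeFactors.exists_max_image id ⟨p, by simp [hp, hpn, h.1.ne']⟩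
  have hpx : p ≤ x := hmax p (by simp [hp, hpn, h.1.ne'])
  have hxn := Nat.dvd_of_mem_primeFactors hx
  have hxp := Nat.prime_of_mem_primeFactors hx
  replace hmax : ∀ q, q.Prime → x < q → ¬ q ∣ n := fun q hq hxq hqn =>
    absurd (hmax q (by simp [hq, hqn, h.1.ne'])) (not_le.2 hxq)
  -- One choice of primes serves every `x` with `b ≤ x < q`; such windows cover the range from 41 to
  -- `2 ^ 25`.
  have hwin : ∀ {p₁ p₂ p₃ q q' r s s' b : ℕ} (T : List ℕ), x < q → b ≤ x → q < q' →
      q.Prime → q'.Prime → q < 2 ^ s' → r.Prime → 2 * s' ≤ r → r < 2 ^ s →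
      p₁.Prime → p₂.Prime → p₃.Prime → p₁ < p₂ → p₂ < p₃ → q * q' < p₁ * p₂ * p₃ →
      (∀ t ∈ T, t.Prime ∧ p₃ ≤ t ∧ t ≤ b) → T.Nodup → 2 * s ≤ T.length + 1 → False :=
    fun T hxq hb hqq hq hq' hqs hr hsr hrs hp₁ hp₂ hp₃ h12 h23 hlt hT hnd hc =>
      h.not_dvd_of_window hM T hxp hxn hq hq' hqq (hmax _ hq hxq) (hmax _ hq' (hxq.trans hqq))
        hqs hr hsr hrs hp₁ hp₂ hp₃ h12 h23 hlt
        (fun t ht => ⟨(hT t ht).1, (hT t ht).2.1, (hT t ht).2.2.trans hb⟩) hnd hc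
  rcases lt_or_ge x 43 with hc | hb
  · exact hwin (b := 41) (q := 43) (q' := 47) (p₁ := 11) (p₂ := 13) (p₃ := 17) (s' := 6)
      (r := 13) (s := 4) [17, 19, 23, 29, 31, 37, 41] hc (by omega)
      (by norm_num) (by norm_num) (by norm_num) (by norm_num) (by norm_num) (by norm_num)
      (by norm_num) (by norm_num) (by norm_num) (by norm_num) (by norm_num) (by norm_num)
      (by norm_num) (by norm_num) (by decide) (by decide)
  rcases lt_or_ge x 61 with hc | hb'
  · exact hwin (b := 43) (q := 61) (q' := 67) (p₁ := 13) (p₂ := 17) (p₃ := 19) (s' := 6)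
      (r := 13) (s := 4) [19, 23, 29, 31, 37, 41, 43] hc hb
      (by norm_num) (by norm_num) (by norm_num) (by norm_num) (by norm_num) (by norm_num)
      (by norm_num) (by norm_num) (by norm_num) (by norm_num) (by norm_num) (by norm_num)
      (by norm_num) (by norm_num) (by decide) (by decide)
  clear hb; rename x ≥ 61 => hb
  rcases lt_or_ge x 109 with hc | hb'
  · exact hwin (b := 61) (q := 109) (q' := 113) (p₁ := 19) (p₂ := 23) (p₃ := 29) (s' := 7)
      (r := 17) (s := 5) [29, 31, 37, 41, 43, 47, 53, 59, 61] hc hb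
      (by norm_num) (by norm_num) (by norm_num) (by norm_num) (by norm_num) (by norm_num)
      (by norm_num) (by norm_num) (by norm_num) (by norm_num) (by norm_num) (by norm_num)
      (by norm_num) (by norm_num) (by decide) (by decide)
  clear hb; rename x ≥ 109 => hb
  rcases lt_or_ge x 577 with hc | hb'
  · exact hwin (b := 109) (q := 577) (q' := 587) (p₁ := 67) (p₂ := 71) (p₃ := 73) (s' := 10)
      (r := 23) (s := 5) [73, 79, 83, 89, 97, 101, 103, 107, 109] hc hb
      (by norm_num) (by norm_num) (by norm_num) (by norm_num) (by norm_num) (by norm_num)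
      (by norm_num) (by norm_num) (by norm_num) (by norm_num) (by norm_num) (by norm_num)
      (by norm_num) (by norm_num) (by decide) (by decide)
  clear hb; rename x ≥ 577 => hb
  rcases lt_or_ge x 11527 with hc | hb'
  · exact hwin (b := 577) (q := 11527) (q' := 11549) (p₁ := 503) (p₂ := 509) (p₃ := 521)
      (s' := 14) (r := 29) (s := 5) [521, 523, 541, 547, 557, 563, 569, 571, 577] hc hb
      (by norm_num) (by norm_num) (by norm_num) (by norm_num) (by norm_num) (by norm_num)
      (by norm_num) (by norm_num) (by norm_num) (by norm_num) (by norm_num) (by norm_num)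
      (by norm_num) (by norm_num) (by decide) (by decide)
  clear hb; rename x ≥ 11527 => hb
  rcases lt_or_ge x 1222681 with hc | hb'
  · exact hwin (b := 11527) (q := 1222681) (q' := 1222693) (p₁ := 11423) (p₂ := 11437)
      (p₃ := 11443) (s' := 21) (r := 43) (s := 6)
      [11443, 11447, 11467, 11471, 11483, 11489, 11491, 11497, 11503, 11519, 11527] hc hb
      (by norm_num) (by norm_num) (by norm_num) (by norm_num) (by norm_num) (by norm_num)
      (by norm_num) (by norm_num) (by norm_num) (by norm_num) (by norm_num) (by norm_num)
      (by norm_num) (by norm_num) (by decide) (by decide)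
  clear hb; rename x ≥ 1222681 => hb
  rcases lt_or_ge x (2 ^ 25) with hc | hb'
  · exact hwin (b := 1222681) (q := 33554467) (q' := 33554473) (p₁ := 1222513)
      (p₂ := 1222523) (p₃ := 1222537) (s' := 26) (r := 53) (s := 6)
      [1222537, 1222561, 1222567, 1222583, 1222597, 1222601, 1222603, 1222633, 1222643,
        1222651, 1222667] (hc.trans (by norm_num)) hb
      (by norm_num) (by norm_num) (by norm_num) (by norm_num) (by norm_num) (by norm_num)
      (by norm_num) (by norm_num) (by norm_num) (by norm_num) (by norm_num) (by norm_num)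
      (by norm_num) (by norm_num) (by decide) (by decide)
  exact h.not_dvd_of_two_pow_le hM hxp hxn hmax hb'

end IsHighlyComposite

/-! ### A verified search over exponent lists. -/

/-- The product of the powers `p ^ a`, for `p` and `a` running through two lists. -/
def primePowerProd : List ℕ → List ℕ → ℕ
  | p :: ps, a :: as => p ^ a * primePowerProd ps as
  | _, _ => 1

/-- The number of divisors of a product of powers of distinct primes with exponents `as`. -/
def divisorCount : List ℕ → ℕ
  | [] => 1
  | a :: as => (a + 1) * divisorCount as

theorem primePowerProd_pos {ps : List ℕ} (hps : ∀ p ∈ ps, p.Prime) (as : List ℕ) :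
    0 < primePowerProd ps as := by
  induction ps generalizing as with
  | nil => simp [primePowerProd]
  | cons p ps ih =>
    cases as with
    | nil => simp [primePowerProd]
    | cons a as =>
      simp only [List.forall_mem_cons] at hps
      exact Nat.mul_pos (pow_pos hps.1.pos a) (ih hps.2 as)

theorem prime_not_dvd_primePowerProd {ps : List ℕ} (hps : ∀ p ∈ ps, p.Prime) {q : ℕ}
    (hq : q.Prime) (hqps : q ∉ ps) (as : List ℕ) : ¬ q ∣ primePowerProd ps as := by
  induction ps generalizing as with
  | nil => simpa [primePowerProd] using hq.one_lt.ne'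
  | cons p ps ih =>
    cases as with
    | nil => simpa [primePowerProd] using hq.one_lt.ne'
    | cons a as =>
      simp only [List.forall_mem_cons] at hps
      simp only [List.mem_cons, not_or] at hqps
      exact hq.not_dvd_pow_mul hps.1 hqps.1 (ih hps.2 hqps.2 as)

theorem card_divisors_primePowerProd {ps : List ℕ} (hps : ∀ p ∈ ps, p.Prime) (hnd : ps.Nodup)
    {as : List ℕ} (hlen : as.length ≤ ps.length) :
    (primePowerProd ps as).divisors.card = divisorCount as := by
  induction ps generalizing as with
  | nil =>
    rw [List.length_nil, Nat.le_zero, List.length_eq_zero_iff] at hlen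
    simp [hlen, primePowerProd, divisorCount]
  | cons p ps ih =>
    cases as with
    | nil => simp [primePowerProd, divisorCount]
    | cons a as =>
      simp only [List.forall_mem_cons] at hps
      rw [List.nodup_cons] at hnd
      rw [primePowerProd, divisorCount, card_divisors_prime_pow_mul a hps.1
        (prime_not_dvd_primePowerProd hps.2 hps.1 hnd.1 as),
        ih hps.2 hnd.2 (by simpa using hlen)]

/-- Decides whether some `m ≤ N` that is a product of powers of the given primes, with
nonincreasing exponents bounded by `A`, has at least `D` divisors (exactly `D` divisors if `e` is
set). -/
def searchDivisorCount (e : Bool) : List ℕ → ℕ → ℕ → ℕ → Bool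
  | [], _, N, D => decide (0 < N) && decide (D ≤ 1)
  | p :: ps, A, N, D =>
    if D ≤ 1 then decide (0 < N) else
      (List.range A).any fun a =>
        decide (p ^ (a + 1) ≤ N) && ((!e || decide (D % (a + 2) = 0)) &&
          searchDivisorCount e ps (a + 1) (N / p ^ (a + 1)) ((D + (a + 1)) / (a + 2)))

/-- Only completeness of the search is needed: a result `false` excludes every such `m`. -/
theorem searchDivisorCount_eq_true (e : Bool) {ps : List ℕ} (hps : ∀ p ∈ ps, p.Prime)
    (hlt : ps.Pairwise (· < ·)) {m A N D : ℕ} (hm : 0 < m)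
    (hanti : ∀ p ∈ ps, ∀ q ∈ ps, p ≤ q → m.factorization q ≤ m.factorization p)
    (hA : ∀ p ∈ ps, m.factorization p ≤ A) (hmem : ∀ p, p.Prime → p ∣ m → p ∈ ps)
    (hN : m ≤ N) (hD : D ≤ m.divisors.card) (he : e = true → D = m.divisors.card) :
    searchDivisorCount e ps A N D = true := by
  induction ps generalizing m A N D with
  | nil =>
    have hm1 : m = 1 := Nat.eq_one_iff_not_exists_prime_dvd.2 fun p hp hd => by
      simpa using hmem p hp hd
    subst hm1
    simp only [Nat.divisors_one, Finset.card_singleton] at hD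
    simp [searchDivisorCount, hD]
    omega
  | cons p ps ih =>
    rw [searchDivisorCount]
    split_ifs with hD1
    · simp; omega
    simp only [List.forall_mem_cons] at hps
    rw [List.pairwise_cons] at hlt
    obtain ⟨w, hw0, hpw, hmw, hw⟩ := exists_eq_pow_mul_coprime hm.ne' hps.1
    -- The search tries only positive exponents: by monotonicity a zero exponent at the first prime
    -- forces `m = 1`.
    have hpos : 0 < m.factorization p := by
      by_contra hc
      have hm1 : m = 1 := Nat.eq_one_iff_not_exists_prime_dvd.2 fun q hq hd => by
        have hqps := hmem q hq hd
        have hle : p ≤ q := by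
          rcases List.mem_cons.1 hqps with rfl | h1
          · exact le_rfl
          · exact (hlt.1 q h1).le
        have := hanti p (by simp) q hqps hle
        have := hq.factorization_pos_of_dvd hm.ne' hd
        omega
      subst hm1
      simp only [Nat.divisors_one, Finset.card_singleton] at hD
      exact hD1 hD
    obtain ⟨a, ha⟩ := Nat.exists_eq_add_of_lt hpos
    rw [zero_add] at ha
    rw [ha] at hmw
    have hne : ∀ q ∈ ps, q ≠ p := fun q hq => (hlt.1 q hq).ne'
    have hcard : m.divisors.card = (a + 2) * w.divisors.card := by
      rw [hmw, card_divisors_prime_pow_mul _ hps.1 hpw]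
    rw [List.any_eq_true]
    refine ⟨a, ?_, ?_⟩
    · have := hA p (by simp)
      rw [List.mem_range]; omega
    · have hp0 : 0 < p ^ (a + 1) := pow_pos hps.1.pos _
      have hwN : p ^ (a + 1) * w ≤ N := hmw ▸ hN
      simp only [Bool.and_eq_true, Bool.or_eq_true, decide_eq_true_eq, Bool.not_eq_true']
      refine ⟨(Nat.le_mul_of_pos_right _ hw0).trans hwN, ?_, ?_⟩
      · cases e with
        | false => simp
        | true => right; rw [he rfl, hcard, Nat.mul_mod_right]
      · refine ih hps.2 hlt.2 hw0 (fun q hq r hr hqr => ?_) (fun q hq => ?_) (fun q hq hd => ?_)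
          ?_ ?_ (fun h => ?_)
        · rw [hw q (hne q hq), hw r (hne r hr)]
          exact hanti q (by simp [hq]) r (by simp [hr]) hqr
        · rw [hw q (hne q hq), ← ha]
          exact hanti p (by simp) q (by simp [hq]) (hlt.1 q hq).le
        · rcases List.mem_cons.1 (hmem q hq (hmw ▸ hd.mul_left _)) with rfl | h1
          · exact absurd hd hpw
          · exact h1
        · rwa [Nat.le_div_iff_mul_le hp0, mul_comm]
        -- The new target is the ceiling of D / (a + 2), the count that the cofactor must still
        -- supply.
        · rw [← Nat.lt_succ_iff, Nat.div_lt_iff_lt_mul (by omega)]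
          rw [hcard] at hD
          nlinarith
        · rw [he h, hcard]
          rw [Nat.mul_add_div (by omega), Nat.div_eq_of_lt (by omega), add_zero]

theorem mem_of_prime_lt_fortyOne : ∀ p < 41, p.Prime →
    p ∈ [2, 3, 5, 7, 11, 13, 17, 19, 23, 29, 31, 37] := by decide

namespace IsHighlyComposite

variable {n : ℕ}

theorem searchDivisorCount_eq_true (h : IsHighlyComposite n)
    (h41 : ∀ p, p.Prime → p ∣ n → p < 41) (e : Bool) {N D : ℕ} (hN : n ≤ N)
    (hD : D ≤ n.divisors.card) (he : e = true → D = n.divisors.card) :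
    searchDivisorCount e [2, 3, 5, 7, 11, 13, 17, 19, 23, 29, 31, 37] 10 N D = true := by
  have hps : ∀ p ∈ [2, 3, 5, 7, 11, 13, 17, 19, 23, 29, 31, 37], p.Prime := by norm_num
  -- As 41 < 2⁶, the exponent of 2 is at most 10, the initial bound of the search.
  have h2 := h.factorization_succ_lt_two_mul (s := 6) Nat.prime_two
    (by norm_num : Nat.Prime 41) (fun hd => absurd (h41 41 (by norm_num) hd) (by norm_num))
    (by norm_num)
  refine _root_.searchDivisorCount_eq_true e hps (by decide) h.1
    (fun p hp q hq hpq => h.factorization_anti (hps p hp) (hps q hq) hpq)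
    (fun p hp => ?_) (fun p hp hd => mem_of_prime_lt_fortyOne p (h41 p hp hd) hp) hN hD he
  have := h.factorization_anti Nat.prime_two (hps p hp) (hps p hp).two_le
  omega

/-- A prime factor from 41 on would force all primes up to 41 to divide `n`; the bound is their
product. -/
theorem prime_lt_of_dvd_of_lt (h : IsHighlyComposite n) (hn : n < 304250263527210) {p : ℕ}
    (hp : p.Prime) (hd : p ∣ n) : p < 41 := by
  by_contra hc
  have hsub : ({2, 3, 5, 7, 11, 13, 17, 19, 23, 29, 31, 37, 41} : Finset ℕ) ⊆ n.primeFactors := by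
    intro q hq
    have hq1 : q.Prime ∧ q ≤ 41 := by
      revert q; norm_num
    have h1 := h.factorization_anti hq1.1 hp (by omega)
    have h2 := hp.factorization_pos_of_dvd h.1.ne' hd
    rw [← Nat.support_factorization, Finsupp.mem_support_iff]
    omega
  have h1 := Nat.le_of_dvd h.1
    ((Finset.prod_dvd_prod_of_subset _ _ id hsub).trans (Nat.prod_primeFactors_dvd n))
  rw [show ∏ q ∈ ({2, 3, 5, 7, 11, 13, 17, 19, 23, 29, 31, 37, 41} : Finset ℕ), id q =
    304250263527210 by decide +kernel] at h1
  omega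

/-- The least number with at least as many divisors as `n` is itself highly composite, so if it were
below `n` the search would find it. -/
theorem of_searchDivisorCount_eq_false (hn : 0 < n) (hlt : n < 304250263527210)
    (hs : searchDivisorCount false [2, 3, 5, 7, 11, 13, 17, 19, 23, 29, 31, 37] 10 (n - 1)
      n.divisors.card = false) : IsHighlyComposite n := by
  classical
  refine ⟨hn, fun m hm hmn => ?_⟩
  by_contra hc
  have hex : ∃ k, 0 < k ∧ n.divisors.card ≤ k.divisors.card := ⟨m, hm, not_lt.1 hc⟩
  have hle : Nat.find hex ≤ m := Nat.find_min' hex ⟨hm, not_lt.1 hc⟩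
  obtain ⟨hk0, hk⟩ := Nat.find_spec hex
  have hHC : IsHighlyComposite (Nat.find hex) := ⟨hk0, fun l hl hlk => by
    have := Nat.find_min hex hlk
    have : ¬ n.divisors.card ≤ l.divisors.card := fun h => this ⟨hl, h⟩
    omega⟩
  have := hHC.searchDivisorCount_eq_true
    (fun p hp hd => hHC.prime_lt_of_dvd_of_lt (by omega) hp hd) false
    (N := n - 1) (by omega) hk (by simp)
  rw [hs] at this
  exact absurd this (by decide)

theorem eq_of_card_divisors_eq (h : IsHighlyComposite n) {m : ℕ} (hm : IsHighlyComposite m)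
    (hd : n.divisors.card = m.divisors.card) : n = m :=
  le_antisymm (h.le_of_card_le hm.1 hd.le) (hm.le_of_card_le h.1 hd.ge)

/-- The exponents in a highly composite number without prime factors above `11`. -/
theorem exists_eq_primePowerProd (h : IsHighlyComposite n) (h13 : ∀ p, p.Prime → p ∣ n → p < 13) :
    ∃ a < 7, ∃ b < 5, ∃ c < 3, ∃ d < 3, ∃ e < 3,
      n = primePowerProd [2, 3, 5, 7, 11] [a, b, c, d, e] := by
  have hn13 : ¬ 13 ∣ n := fun hd => absurd (h13 13 (by norm_num) hd) (by norm_num)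
  have hp13 : Nat.Prime 13 := by norm_num
  have h2 := h.factorization_succ_lt_two_mul (r := 2) (s := 4) (by norm_num) hp13 hn13 (by norm_num)
  have h3 := h.factorization_succ_lt_two_mul (r := 3) (s := 3) (by norm_num) hp13 hn13 (by norm_num)
  have h5 := h.factorization_succ_lt_two_mul (r := 5) (s := 2) (by norm_num) hp13 hn13 (by norm_num)
  have h7 := h.factorization_succ_lt_two_mul (r := 7) (s := 2) (by norm_num) hp13 hn13 (by norm_num)
  have h11 := h.factorization_succ_lt_two_mul (r := 11) (s := 2) (by norm_num) hp13 hn13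
    (by norm_num)
  refine ⟨n.factorization 2, by omega, n.factorization 3, by omega, n.factorization 5, by omega,
    n.factorization 7, by omega, n.factorization 11, by omega, ?_⟩
  conv_lhs => rw [← Nat.prod_factorization_pow_eq_self h.1.ne']
  have hsub : n.factorization.support ⊆ {2, 3, 5, 7, 11} := fun p hp => by
    rw [Nat.support_factorization] at hp
    have hpp := Nat.prime_of_mem_primeFactors hp
    have := h13 p hpp (Nat.dvd_of_mem_primeFactors hp)
    revert hpp
    clear hp
    interval_cases p <;> norm_num
  rw [Finsupp.prod_of_support_subset _ hsub _ (by simp)]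
  simp [primePowerProd]

end IsHighlyComposite

/-! ### Certificates and the final classification. -/

/-- The primes below `50`. -/
def primesBelowFifty : List ℕ := [2, 3, 5, 7, 11, 13, 17, 19, 23, 29, 31, 37, 41, 43, 47]

/-- The prime exponents of the highly composite numbers whose divisor count is highly composite. -/
def pairExponents : List (List ℕ) :=
   [[], [1], [1, 1], [2, 1], [2, 1, 1], [3, 2, 1], [2, 2, 1, 1], [3, 2, 1, 1], [4, 2, 1, 1],
    [4, 2, 1, 1, 1], [4, 2, 2, 1, 1], [4, 2, 1, 1, 1, 1], [4, 2, 2, 1, 1, 1],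
    [4, 2, 2, 1, 1, 1, 1], [6, 4, 2, 1, 1, 1, 1], [6, 4, 2, 2, 1, 1, 1, 1],
    [6, 4, 2, 2, 1, 1, 1, 1, 1], [6, 4, 2, 2, 1, 1, 1, 1, 1, 1]]

/-- The prime exponents of the highly composite divisor counts of highly composite numbers. -/
def pairCountExponents : List (List ℕ) :=
   [[], [1], [2], [1, 1], [2, 1], [3, 1], [2, 2], [4, 1], [2, 1, 1], [3, 1, 1], [2, 2, 1],
    [4, 1, 1], [3, 2, 1], [4, 2, 1], [4, 1, 1, 1], [4, 2, 1, 1], [5, 2, 1, 1], [6, 2, 1, 1]]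

/-- The highly composite `M` without prime factors above `11` that are not the divisor count of a
highly composite number, with the exponents of a number that has at least `M` divisors and is less
than every number that has exactly `M` divisors. -/
def unattainedCounts : List (ℕ × List ℕ) :=
   [(840, [5, 2, 2, 1, 1, 1, 1]), (1260, [4, 3, 1, 1, 1, 1, 1, 1]),
    (2520, [6, 3, 2, 1, 1, 1, 1, 1]), (7560, [7, 4, 2, 1, 1, 1, 1, 1, 1]),
    (15120, [7, 4, 2, 1, 1, 1, 1, 1, 1, 1]), (25200, [8, 4, 2, 2, 1, 1, 1, 1, 1, 1]),
    (27720, [6, 3, 3, 1, 1, 1, 1, 1, 1, 1, 1]), (45360, [7, 4, 2, 2, 1, 1, 1, 1, 1, 1, 1]),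
    (50400, [8, 4, 2, 2, 1, 1, 1, 1, 1, 1, 1]), (55440, [9, 4, 2, 2, 1, 1, 1, 1, 1, 1, 1]),
    (83160, [6, 3, 3, 2, 1, 1, 1, 1, 1, 1, 1, 1]), (110880, [9, 4, 2, 2, 1, 1, 1, 1, 1, 1, 1, 1]),
    (166320, [6, 3, 3, 2, 1, 1, 1, 1, 1, 1, 1, 1, 1]),
    (221760, [9, 4, 2, 2, 1, 1, 1, 1, 1, 1, 1, 1, 1]),
    (277200, [7, 3, 2, 2, 1, 1, 1, 1, 1, 1, 1, 1, 1, 1]),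
    (332640, [6, 3, 3, 2, 1, 1, 1, 1, 1, 1, 1, 1, 1, 1]),
    (498960, [6, 5, 3, 2, 1, 1, 1, 1, 1, 1, 1, 1, 1, 1]),
    (554400, [7, 5, 3, 2, 1, 1, 1, 1, 1, 1, 1, 1, 1, 1]),
    (665280, [6, 3, 3, 2, 1, 1, 1, 1, 1, 1, 1, 1, 1, 1, 1])]

/-- The prime exponents of numbers whose divisor counts rule out that the remaining numbers without
prime factors above `11` are highly composite. -/
def manyDivisorsExponents : List (List ℕ) :=
   [[], [1], [2], [1, 1], [2, 1], [3, 1], [2, 2], [4, 1], [2, 1, 1], [3, 1, 1], [2, 2, 1],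
    [4, 1, 1], [3, 2, 1], [4, 2, 1], [3, 1, 1, 1], [2, 2, 1, 1], [4, 1, 1, 1], [3, 2, 1, 1],
    [4, 2, 1, 1], [3, 3, 1, 1], [5, 2, 1, 1], [4, 3, 1, 1], [6, 2, 1, 1], [4, 2, 2, 1],
    [3, 2, 1, 1, 1], [4, 4, 1, 1], [5, 2, 2, 1], [4, 2, 1, 1, 1], [3, 3, 1, 1, 1],
    [5, 2, 1, 1, 1], [4, 3, 1, 1, 1], [6, 2, 1, 1, 1], [4, 2, 2, 1, 1], [5, 3, 1, 1, 1],
    [4, 4, 1, 1, 1], [5, 2, 2, 1, 1], [6, 3, 1, 1, 1], [4, 2, 1, 1, 1, 1], [3, 3, 1, 1, 1, 1],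
    [5, 2, 1, 1, 1, 1], [4, 3, 1, 1, 1, 1], [6, 2, 1, 1, 1, 1], [4, 2, 2, 1, 1, 1],
    [5, 2, 2, 1, 1, 1], [4, 3, 2, 1, 1, 1], [5, 3, 2, 1, 1, 1], [4, 2, 2, 1, 1, 1, 1],
    [4, 3, 2, 1, 1, 1, 1]]

theorem prime_of_mem_primesBelowFifty : ∀ p ∈ primesBelowFifty, p.Prime := by
  norm_num [primesBelowFifty]

theorem card_divisors_primePowerProd_primesBelowFifty {as : List ℕ} (h : as.length ≤ 15) :
    (primePowerProd primesBelowFifty as).divisors.card = divisorCount as :=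
  card_divisors_primePowerProd prime_of_mem_primesBelowFifty (by decide) h

theorem isHighlyComposite_primePowerProd {as : List ℕ} (hlen : as.length ≤ 15)
    (hlt : primePowerProd primesBelowFifty as < 304250263527210)
    (hs : searchDivisorCount false [2, 3, 5, 7, 11, 13, 17, 19, 23, 29, 31, 37] 10
      (primePowerProd primesBelowFifty as - 1) (divisorCount as) = false) :
    IsHighlyComposite (primePowerProd primesBelowFifty as) :=
  .of_searchDivisorCount_eq_false (primePowerProd_pos prime_of_mem_primesBelowFifty as) hlt
    (by rwa [card_divisors_primePowerProd_primesBelowFifty hlen])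

theorem length_le_of_mem_pairExponents : ∀ as ∈ pairExponents, as.length ≤ 15 := by decide

theorem isHighlyComposite_of_mem_pairExponents :
    ∀ as ∈ pairExponents, IsHighlyComposite (primePowerProd primesBelowFifty as) := by
  have h : ∀ as ∈ pairExponents, primePowerProd primesBelowFifty as < 304250263527210 ∧
      searchDivisorCount false [2, 3, 5, 7, 11, 13, 17, 19, 23, 29, 31, 37] 10
        (primePowerProd primesBelowFifty as - 1) (divisorCount as) = false := by
    decide +kernel
  exact fun as has => isHighlyComposite_primePowerProd (length_le_of_mem_pairExponents as has)
    (h as has).1 (h as has).2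

theorem isHighlyComposite_of_mem_pairCountExponents :
    ∀ as ∈ pairCountExponents, IsHighlyComposite (primePowerProd primesBelowFifty as) := by
  have h : ∀ as ∈ pairCountExponents, as.length ≤ 15 ∧
      primePowerProd primesBelowFifty as < 304250263527210 ∧
      searchDivisorCount false [2, 3, 5, 7, 11, 13, 17, 19, 23, 29, 31, 37] 10
        (primePowerProd primesBelowFifty as - 1) (divisorCount as) = false := by
    decide +kernel
  exact fun as has => isHighlyComposite_primePowerProd (h as has).1 (h as has).2.1 (h as has).2.2

theorem isHighlyComposite_divisorCount_of_mem_pairExponents :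
    ∀ as ∈ pairExponents, IsHighlyComposite (divisorCount as) := by
  have h : ∀ as ∈ pairExponents, ∃ bs ∈ pairCountExponents,
      divisorCount as = primePowerProd primesBelowFifty bs := by decide +kernel
  intro as has
  obtain ⟨bs, hbs, he⟩ := h as has
  exact he ▸ isHighlyComposite_of_mem_pairCountExponents bs hbs

-- In the third case a smaller number with at least as many divisors shows that the candidate is not
-- highly composite.
set_option synthInstance.maxSize 1024 in
set_option synthInstance.maxHeartbeats 200000 in
theorem primePowerProd_mem_or_exists_card_le : ∀ a < 7, ∀ b < 5, ∀ c < 3, ∀ d < 3, ∀ e < 3,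
    (∃ as ∈ pairExponents, divisorCount as = primePowerProd [2, 3, 5, 7, 11] [a, b, c, d, e]) ∨
    (∃ x ∈ unattainedCounts, x.1 = primePowerProd [2, 3, 5, 7, 11] [a, b, c, d, e]) ∨
    ∃ as ∈ manyDivisorsExponents, as.length ≤ 15 ∧
      primePowerProd primesBelowFifty as < primePowerProd [2, 3, 5, 7, 11] [a, b, c, d, e] ∧
      divisorCount [a, b, c, d, e] ≤ divisorCount as := by
  decide +kernel

theorem IsHighlyComposite.mem_of_prime_lt {M : ℕ} (hM : IsHighlyComposite M)
    (h13 : ∀ p, p.Prime → p ∣ M → p < 13) :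
    (∃ as ∈ pairExponents, divisorCount as = M) ∨ ∃ x ∈ unattainedCounts, x.1 = M := by
  obtain ⟨a, ha, b, hb, c, hc, d, hd, e, he, hMe⟩ := hM.exists_eq_primePowerProd h13
  rcases primePowerProd_mem_or_exists_card_le a ha b hb c hc d hd e he with h | h | h
  · exact .inl (hMe ▸ h)
  · exact .inr (hMe ▸ h)
  · obtain ⟨as, -, hlen, hlt, hle⟩ := h
    have h1 := hM.2 _ (primePowerProd_pos prime_of_mem_primesBelowFifty as) (hMe ▸ hlt)
    rw [card_divisors_primePowerProd_primesBelowFifty hlen, hMe,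
      card_divisors_primePowerProd (by norm_num) (by decide) (by simp)] at h1
    omega

theorem IsHighlyComposite.card_divisors_ne_unattained {n : ℕ} (h : IsHighlyComposite n)
    (h41 : ∀ p, p.Prime → p ∣ n → p < 41) : ∀ x ∈ unattainedCounts, x.1 ≠ n.divisors.card := by
  have hs : ∀ x ∈ unattainedCounts, x.2.length ≤ 15 ∧ x.1 ≤ divisorCount x.2 ∧
      searchDivisorCount true [2, 3, 5, 7, 11, 13, 17, 19, 23, 29, 31, 37] 10
        (primePowerProd primesBelowFifty x.2) x.1 = false := by
    decide +kernel
  intro x hx he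
  obtain ⟨h1, h2, h3⟩ := hs x hx
  rw [← card_divisors_primePowerProd_primesBelowFifty h1] at h2
  -- Minimality puts `n` at or below the witness, where the exact search finds nothing.
  have hle := h.le_of_card_le (primePowerProd_pos prime_of_mem_primesBelowFifty x.2) (he ▸ h2)
  rw [h.searchDivisorCount_eq_true h41 true hle he.le fun _ => he] at h3
  exact absurd h3 (by decide)

theorem isHighlyComposite_pair_iff {n : ℕ} :
    IsHighlyComposite n ∧ IsHighlyComposite n.divisors.card ↔
      n ∈ pairExponents.map (primePowerProd primesBelowFifty) := by
  rw [List.mem_map]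
  constructor
  · rintro ⟨h, hM⟩
    have h41 : ∀ p, p.Prime → p ∣ n → p < 41 := fun p hp hd => h.prime_lt_of_dvd hM hp hd
    have h13 : ∀ p, p.Prime → p ∣ n.divisors.card → p < 13 := fun p hp hd => by
      have h1 := h.prime_le_of_dvd_card_divisors hp hd
      have h2 := h.factorization_succ_lt_two_mul (s := 6) Nat.prime_two
        (by norm_num : Nat.Prime 41) (fun hd => absurd (h41 41 (by norm_num) hd) (by norm_num))
        (by norm_num)
      have h3 : p ≠ 12 := by rintro rfl; norm_num at hp
      omega
    rcases hM.mem_of_prime_lt h13 with ⟨as, has, he⟩ | ⟨x, hx, he⟩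
    · refine ⟨as, has, (isHighlyComposite_of_mem_pairExponents as has).eq_of_card_divisors_eq h ?_⟩
      rw [card_divisors_primePowerProd_primesBelowFifty (length_le_of_mem_pairExponents as has), he]
    · exact absurd he (h.card_divisors_ne_unattained h41 x hx)
  · rintro ⟨as, has, rfl⟩
    refine ⟨isHighlyComposite_of_mem_pairExponents as has, ?_⟩
    rw [card_divisors_primePowerProd_primesBelowFifty (length_le_of_mem_pairExponents as has)]
    exact isHighlyComposite_divisorCount_of_mem_pairExponents as has

theorem map_primePowerProd_pairExponents :
    pairExponents.map (primePowerProd primesBelowFifty) =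
      [1, 2, 6, 12, 60, 360, 1260, 2520, 5040, 55440, 277200, 720720, 3603600, 61261200,
        2205403200, 293318625600, 6746328388800, 195643523275200] := by
  decide +kernel

theorem mainTheorem2 :
    {n : ℕ | IsHighlyComposite n ∧ IsHighlyComposite n.divisors.card} =
      {1, 2, 6, 12, 60, 360, 1260, 2520, 5040, 55440, 277200, 720720, 3603600, 61261200,
        2205403200, 293318625600, 6746328388800, 195643523275200} ∧
    ([1, 2, 6, 12, 60, 360, 1260, 2520, 5040, 55440, 277200, 720720, 3603600, 61261200,
        2205403200, 293318625600, 6746328388800, 195643523275200] : List ℕ).map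
          (fun n => n.divisors.card) =
      [1, 2, 4, 6, 12, 24, 36, 48, 60, 120, 180, 240, 360, 720, 1680, 5040, 10080, 20160] := by
  constructor
  · ext n
    rw [Set.mem_ofPred_eq, isHighlyComposite_pair_iff, map_primePowerProd_pairExponents]
    simp only [List.mem_cons, List.not_mem_nil, or_false, Set.mem_insert_iff,
      Set.mem_singleton_iff]
  · rw [← map_primePowerProd_pairExponents, List.map_map]
    refine (List.map_congr_left fun as has => card_divisors_primePowerProd_primesBelowFifty
      (length_le_of_mem_pairExponents as has)).trans ?_
    decide +kernel
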